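/- Let $m \ge 5$, and let $k,\ell$ be integers coprime to $m$ with $0 < k,\ell < \frac m2$. Consider the functions $f,g\colon \mathbb F_{2^m}\to\mathbb F_{2^m}$, $f(x)=x^{2^k+1}$ and $g(x)=x^{2^\ell+1}$. Two functions $f,g$ on $\mathbb F_{2^m}$ are called CCZ-equivalent if some $\mathbb F_2$-affine permutation of $\mathbb F_{2^m}\times\mathbb F_{2^m}$ maps the graph $\{(x,f(x)) : x\in\mathbb F_{2^m}\}$ onto $\{(x,g(x)) : x\in\mathbb F_{2^m}\}$, and linearly equivalent if there are $\mathbb F_2$-linear permutations $A_1,A_2$ of $\mathbb F_{2^m}$ with $f(A_1(x))=A_2(g(x))$ for all $x$. Then $f$ and $g$ are CCZ-equivalent if and only if $k=\ell$. If $k=\ell$, then $f$ and $g$ are linearly equivalent. Moreover, in this case, for linearized polynomials $L(X)=\sum_{i=0}^{m-1}a_iX^{2^i}$ and $N(X)=\sum_{i=0}^{m-1}b_iX^{2^i}$ over $\mathbb F_{2^m}$, the equation $f(L(x))=N(g(x))$ holds for all $x\in\mathbb F_{2^m}$ if and only if there are $u\in\{0,\dots,m-1\}$ and $a\in\mathbb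 F_{2^m}$ with $L(X)=aX^{2^u}$ and $N(X)=a^{2^k+1}X^{2^u}$. Likewise, $L$ and $N$ are permutation polynomials of $\mathbb F_{2^m}$ satisfying this equation if and only if $L$ and $N$ have this form with $a\neq 0$. -/

import Mathlib

/-- The Gold function `x ↦ x ^ (2 ^ k + 1)`. -/
def goldFunction (F : Type*) [Field F] (k : ℕ) (x : F) : F := x ^ (2 ^ k + 1)

/-- The graph `{(x, f x)}` of a function on `F`. -/
def functionGraph {F : Type*} (f : F → F) : Set (F × F) := {p | p.2 = f p.1}

/-- CCZ-equivalence: an `𝔽₂`-affine permutation of `F × F` maps the graph of `f` onto that of `g`. -/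
def CCZEquivalent {F : Type*} [Field F] [Algebra (ZMod 2) F] (f g : F → F) : Prop :=
  ∃ C : (F × F) ≃ᵃ[ZMod 2] (F × F), C '' functionGraph f = functionGraph g

/-- Linear equivalence: `f ∘ A₁ = A₂ ∘ g` for some `𝔽₂`-linear permutations `A₁`, `A₂` of `F`. -/
def LinearlyEquivalent {F : Type*} [Field F] [Algebra (ZMod 2) F] (f g : F → F) : Prop :=
  ∃ A₁ A₂ : F ≃ₗ[ZMod 2] F, ∀ x, f (A₁ x) = A₂ (g x)

/-- Linearized polynomials `∑ αᵢ X ^ (2 ^ i)`: only exponents that are powers of two occur. -/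
def IsLinearizedPoly {F : Type*} [Field F] (P : Polynomial F) : Prop :=
  ∀ n : ℕ, P.coeff n ≠ 0 → ∃ i : ℕ, n = 2 ^ i

/-- A permutation polynomial of `F`: its evaluation map is a bijection of `F`. -/
def IsPermutationPoly {F : Type*} [Field F] (P : Polynomial F) : Prop :=
  Function.Bijective fun x : F => P.eval x

/-! Write `κ` and `lam` for the automorphisms x ↦ x^(2^k) and x ↦ x^(2^l); each generates the Galois
group, which is cyclic of order m. Projecting a CCZ-equivalence to its first coordinate and removing
the translation gives a surjection P(x) = A x + B(κ x * x) such that lam(P) * P is again a linear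
map plus a linear map of κ x * x. The left side has algebraic degree up to 4, the right side at most
2, so polarizing four times leaves an identity in B alone (`fourth_polarization`).

Expand B in automorphisms with coefficients b. Comparing coefficients makes b proportional to its
twist by `lam` at all pairs that are not edges of the cycle s ↦ κ * s
(`proportional_of_quadrilinear`). Since `lam` is not κ or κ⁻¹, nonvanishing of b spreads along
`lam`, and length at least 5 makes the proportionality global (`proportional_twist`). Then B has
rank at most one over 𝔽₂. If B ≠ 0, the third polarization forces |F| ≤ 8; if B = 0, the same
argument bounds the rank of the surjection A by one. Both contradict |F| ≥ 32.

For f ∘ L = N ∘ f the twist is by κ itself, so nonvanishing need not spread: the coefficients of L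
vanish nowhere or are supported at one point (`ne_zero_or_support_subsingleton`). The first case
gives L = 0, the second a monomial; N is then determined by its polar values. -/

/-! ### Linear maps of F as combinations of automorphisms. -/

section FrobeniusExpansion

variable {F : Type*} [Field F] [Algebra (ZMod 2) F]

/-- The automorphisms of `F`, as vectors in the space of functions `F → F`, are linearly
independent. -/
lemma linearIndependent_aut :
    LinearIndependent F (fun σ : F ≃ₐ[ZMod 2] F => (σ : F → F)) :=
  (linearIndependent_monoidHom F F).comp
    (fun σ : F ≃ₐ[ZMod 2] F => ((σ : F →+* F) : F →* F)) fun σ τ h => by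
      ext x
      exact DFunLike.congr_fun h x

/-- Weights that extract the coefficients of an `F`-combination of automorphisms. -/
lemma exists_extraction_weights [Fintype F] [DecidableEq (F ≃ₐ[ZMod 2] F)] :
    ∃ e : (F ≃ₐ[ZMod 2] F) → F → F, ∀ σ τ : F ≃ₐ[ZMod 2] F,
      ∑ x, e σ x * τ x = if τ = σ then 1 else 0 := by
  classical
  let b := Module.Basis.extend (linearIndependent_aut (F := F)).linearIndepOn_id
  have hb (τ : F ≃ₐ[ZMod 2] F) : ∃ i, b i = (τ : F → F) := by
    have hτ : (τ : F → F) ∈ (linearIndependent_aut (F := F)).linearIndepOn_id.extend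
        (Set.subset_univ _) :=
      LinearIndepOn.subset_extend _ _ ⟨τ, rfl⟩
    exact ⟨⟨_, hτ⟩, Module.Basis.extend_apply_self _ _⟩
  choose i hi using hb
  -- The weights are the values of a dual basis functional on the indicator functions of points.
  refine ⟨fun σ x => b.coord (i σ) (fun j => if x = j then 1 else 0), fun σ τ => ?_⟩
  have h := LinearMap.pi_apply_eq_sum_univ (b.coord (i σ)) (τ : F → F)
  simp only [smul_eq_mul] at h
  rw [Finset.sum_congr rfl fun x _ => mul_comm _ _, ← h, ← hi τ, Module.Basis.coord_apply,
    Module.Basis.repr_self, Finsupp.single_apply]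
  refine if_congr ⟨fun h => ?_, fun h => by rw [h]⟩ rfl rfl
  apply DFunLike.coe_injective
  rw [← hi τ, ← hi σ, h]

variable [Finite F]

/-- Every `𝔽₂`-linear map of `F` is a combination of automorphisms. -/
lemma exists_aut_expansion (A : F →ₗ[ZMod 2] F) :
    ∃ a : (F ≃ₐ[ZMod 2] F) → F, ∀ x, A x = ∑ σ, a σ * σ x := by
  classical
  have hli : LinearIndependent F (fun σ : F ≃ₐ[ZMod 2] F => (σ : F →ₐ[ZMod 2] F).toLinearMap) :=
    (linearIndependent_toLinearMap (ZMod 2) F F).comp _ fun σ τ h => by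
      ext x
      exact DFunLike.congr_fun h x
  -- An independent family that is as large as the dimension spans.
  have hcard : Fintype.card (F ≃ₐ[ZMod 2] F) = Module.finrank F (F →ₗ[ZMod 2] F) := by
    rw [Module.finrank_linearMap, Module.finrank_self, mul_one, ← IsGalois.card_aut_eq_finrank,
      Nat.card_eq_fintype_card]
  have hspan := hli.span_eq_top_of_card_eq_finrank hcard
  have hA : A ∈ Submodule.span F (Set.range fun σ : F ≃ₐ[ZMod 2] F =>
      (σ : F →ₐ[ZMod 2] F).toLinearMap) := hspan ▸ Submodule.mem_top
  obtain ⟨a, ha⟩ := (Submodule.mem_span_range_iff_exists_fun F).1 hA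
  refine ⟨a, fun x => ?_⟩
  rw [← ha]
  simp [LinearMap.sum_apply]

lemma aut_comm (σ τ : F ≃ₐ[ZMod 2] F) (x : F) : σ (τ x) = τ (σ x) := by
  have h : σ * τ = τ * σ := IsCyclic.commGroup.mul_comm σ τ
  exact DFunLike.congr_fun h x

/-- An element fixed by a generator of the Galois group is `0` or `1`. -/
lemma eq_zero_or_one_of_fixed {lam : F ≃ₐ[ZMod 2] F}
    (hlam : ∀ σ, σ ∈ Subgroup.zpowers lam) {x : F} (hx : lam x = x) : x = 0 ∨ x = 1 := by
  have hfix : ∀ σ : F ≃ₐ[ZMod 2] F, σ x = x := by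
    intro σ
    have : Subgroup.zpowers lam ≤ MulAction.stabilizer (F ≃ₐ[ZMod 2] F) x := by
      rw [Subgroup.zpowers_le]
      exact hx
    exact this (hlam σ)
  obtain ⟨y, rfl⟩ := Algebra.mem_bot.1 ((IsGalois.mem_bot_iff_fixed x).2 hfix)
  fin_cases y
  · exact Or.inl (map_zero _)
  · exact Or.inr (map_one _)

end FrobeniusExpansion

/-! ### Proportional families off the edges of a cycle. -/

section CycleCombinatorics

variable {G F : Type*} [Group G] [Finite G] [Field F]

lemma forall_of_generator {κ : G} (hκ : ∀ g, g ∈ Subgroup.zpowers κ) {p : G → Prop}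
    (hstep : ∀ s, p s → p (κ * s)) {s : G} (hs : p s) (t : G) : p t := by
  obtain ⟨n, hn⟩ := mem_powers_iff_mem_zpowers.2 (hκ (t * s⁻¹))
  replace hn : κ ^ n = t * s⁻¹ := hn
  have h (n : ℕ) : p (κ ^ n * s) := by
    induction n with
    | zero => simpa using hs
    | succ n ih => rw [pow_succ', mul_assoc]; exact hstep _ ih
  have := h n
  rw [hn] at this
  simpa using this

/-- If two nowhere vanishing families are proportional away from the edges of the cycle
`s ↦ κ * s` of length at least `5`, then they are proportional. -/
lemma proportional_of_offCycle {κ : G} (hκ : ∀ g, g ∈ Subgroup.zpowers κ) (h5 : 5 ≤ orderOf κ)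
    {α a : G → F} (ha : ∀ s, a s ≠ 0)
    (h : ∀ s t, s ≠ t → s ≠ κ * t → t ≠ κ * s → α s * a t = α t * a s) (s t : G) :
    α s * a t = α t * a s := by
  have hp (n : ℕ) (h0 : 0 < n) (hn : n < 5) : κ ^ n ≠ 1 :=
    pow_ne_one_of_lt_orderOf h0.ne' (hn.trans_le h5)
  have h1 : κ ≠ 1 := by simpa using hp 1 (by norm_num) (by norm_num)
  have h2 : κ * κ ≠ 1 := by simpa [pow_succ] using hp 2 (by norm_num) (by norm_num)
  have h3 : κ * (κ * κ) ≠ 1 := by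
    simpa [pow_succ, mul_assoc] using hp 3 (by norm_num) (by norm_num)
  have h4 : κ * (κ * (κ * κ)) ≠ 1 := by
    simpa [pow_succ, mul_assoc] using hp 4 (by norm_num) (by norm_num)
  -- Neighbours s and κs are both compared with κ³s, at distances 3 and 2 along the cycle; length at
  -- least 5 keeps both pairs off the edges.
  have key (s : G) : α (κ * s) / a (κ * s) = α s / a s := by
    have e1 : α s * a (κ * (κ * (κ * s))) = α (κ * (κ * (κ * s))) * a s := by
      apply h
      · intro h'
        apply h3
        have : (κ * (κ * κ)) * s = s := by simpa [mul_assoc] using h'.symm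
        simpa using this
      · intro h'
        apply h4
        have : (κ * (κ * (κ * κ))) * s = s := by simpa [mul_assoc] using h'.symm
        simpa using this
      · intro h'
        apply h2
        have : (κ * κ) * s = s := by simpa [mul_assoc] using h'
        simpa using this
    have e2 : α (κ * s) * a (κ * (κ * (κ * s))) = α (κ * (κ * (κ * s))) * a (κ * s) := by
      apply h
      · intro h'
        apply h2
        have : (κ * κ) * s = s := by simpa [mul_assoc] using h'.symm
        simpa using this
      · intro h'
        apply h3
        have : (κ * (κ * κ)) * s = s := by simpa [mul_assoc] using h'.symm
        simpa using this
      · intro h'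
        apply h1
        simpa using h'
    rw [div_eq_div_iff (ha _) (ha _)]
    apply mul_right_cancel₀ (ha (κ * (κ * (κ * s))))
    linear_combination a s * e2 - a (κ * s) * e1
  have hs := forall_of_generator hκ (p := fun t => α t / a t = α s / a s)
    (fun u hu => (key u).trans hu) rfl t
  rw [div_eq_div_iff (ha _) (ha _)] at hs
  exact hs.symm

/-- A family that is proportional, away from the edges of the cycle of `κ`, to its twist along
a second generator `lam ≠ κ, κ⁻¹`, is proportional to it everywhere. -/
lemma proportional_twist {κ lam : G} (hκ : ∀ g, g ∈ Subgroup.zpowers κ)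
    (hlam : ∀ g, g ∈ Subgroup.zpowers lam) (h5 : 5 ≤ orderOf κ)
    (hne : lam ≠ κ) (hne' : κ * lam ≠ 1)
    {α a : G → F} (hα : ∀ s, α (lam * s) = 0 → a s = 0)
    (h : ∀ s t, s ≠ t → s ≠ κ * t → t ≠ κ * s → α s * a t = α t * a s) (s t : G) :
    α s * a t = α t * a s := by
  have hlam1 : lam ≠ 1 := by
    rintro rfl
    have := hlam κ
    rw [Subgroup.zpowers_one_eq_bot, Subgroup.mem_bot] at this
    rw [this, orderOf_one] at h5
    omega
  -- The pair (lam * s, s) is not an edge, as lam is none of 1, κ, κ⁻¹.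
  have hstep (s : G) (hs : a s ≠ 0) : a (lam * s) ≠ 0 := by
    intro h0
    have := h (lam * s) s (by simpa using hlam1) (by simpa using hne)
      (by intro h'; apply hne'; rw [← mul_assoc] at h'; simpa using h'.symm)
    rw [h0, mul_zero] at this
    exact hs ((mul_eq_zero.1 this).elim (hα s) id)
  by_cases h0 : ∀ s, a s = 0
  · simp [h0]
  · push Not at h0
    obtain ⟨u, hu⟩ := h0
    exact proportional_of_offCycle hκ h5 (forall_of_generator hlam hstep hu) h s t

/-- A family that is proportional to its twist along `κ`, away from the edges of the cycle of `κ`,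
is nowhere zero or supported in one point. -/
lemma ne_zero_or_support_subsingleton {κ : G} (h5 : 5 ≤ orderOf κ)
    (hκ : ∀ g, g ∈ Subgroup.zpowers κ) {α a : G → F} (hα : ∀ s, α (κ * s) = 0 → a s = 0)
    (h : ∀ s t, s ≠ t → s ≠ κ * t → t ≠ κ * s → α s * a t = α t * a s) :
    (∀ s, a s ≠ 0) ∨ ∃ s, ∀ t, t ≠ s → a t = 0 := by
  have hp (n : ℕ) (h0 : 0 < n) (hn : n < 5) : κ ^ n ≠ 1 :=
    pow_ne_one_of_lt_orderOf h0.ne' (hn.trans_le h5)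
  have h2 : κ * κ ≠ 1 := by simpa [pow_succ] using hp 2 (by norm_num) (by norm_num)
  have h3 : κ * (κ * κ) ≠ 1 := by
    simpa [pow_succ, mul_assoc] using hp 3 (by norm_num) (by norm_num)
  have h4 : κ * (κ * (κ * κ)) ≠ 1 := by
    simpa [pow_succ, mul_assoc] using hp 4 (by norm_num) (by norm_num)
  have h1 : κ ≠ 1 := by simpa using hp 1 (by norm_num) (by norm_num)
  -- Where the support stops, at s, any other support point must be joined to κs by an edge.
  have key (s t : G) (hs : a s ≠ 0) (hs' : a (κ * s) = 0) (ht : a t ≠ 0) :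
      t = s ∨ t = κ * (κ * s) := by
    by_contra! hc
    have := h (κ * s) t (by rintro rfl; exact ht hs') (by simpa using hc.1.symm) hc.2
    rw [hs', mul_zero] at this
    exact hs (hα s ((mul_eq_zero.1 this).resolve_right ht))
  by_cases hall : ∀ s, a s ≠ 0 → a (κ * s) ≠ 0
  · by_cases h0 : ∀ s, a s = 0
    · exact Or.inr ⟨1, fun t _ => h0 t⟩
    · push Not at h0
      obtain ⟨u, hu⟩ := h0
      exact Or.inl (forall_of_generator hκ hall hu)
  · push Not at hall
    obtain ⟨s, hs, hs'⟩ := hall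
    refine Or.inr ⟨s, fun t hts => ?_⟩
    by_contra ht
    obtain rfl := (key s t hs hs' ht).resolve_left hts
    -- The support would also stop at κ²s, so `key` applied there puts s in {κ²s, κ⁴s}.
    have h3' : a (κ * (κ * (κ * s))) = 0 := by
      by_contra h'
      rcases key s _ hs hs' h' with e | e
      · apply h3
        have : (κ * (κ * κ)) * s = s := by simpa [mul_assoc] using e
        simpa using this
      · exact h1 (by simpa using e)
    rcases key _ s ht h3' hs with e | e
    · exact hts e.symm
    · apply h4
      have : (κ * (κ * (κ * κ))) * s = s := by simpa [mul_assoc] using e.symm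
      simpa using this

end CycleCombinatorics

/-! ### Polar forms and extraction of their coefficients. -/

section Polar

variable {F : Type*} [Field F] [Algebra (ZMod 2) F]

/-- The polar form of the quadratic map `x ↦ σ x * x`. -/
def autPolar (σ : F ≃ₐ[ZMod 2] F) (x y : F) : F := σ x * y + x * σ y

/-- The coefficients of `σ ∘ A` if those of `A` are `a`. -/
def twistCoeff (σ : F ≃ₐ[ZMod 2] F) (a : (F ≃ₐ[ZMod 2] F) → F) (s : F ≃ₐ[ZMod 2] F) : F :=
  σ (a (σ⁻¹ * s))

lemma eq_zero_of_twistCoeff (σ : F ≃ₐ[ZMod 2] F) (a : (F ≃ₐ[ZMod 2] F) → F)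
    (s : F ≃ₐ[ZMod 2] F) (h : twistCoeff σ a (σ * s) = 0) : a s = 0 := by
  simpa [twistCoeff] using h

section

variable [Finite F]

lemma apply_aut_expansion (σ : F ≃ₐ[ZMod 2] F) {A : F →ₗ[ZMod 2] F}
    {a : (F ≃ₐ[ZMod 2] F) → F} (hA : ∀ x, A x = ∑ τ, a τ * τ x) (x : F) :
    σ (A x) = ∑ τ, twistCoeff σ a τ * τ x := by
  rw [hA, map_sum, ← Equiv.sum_comp (Equiv.mulLeft σ) fun τ => twistCoeff σ a τ * τ x]
  refine Finset.sum_congr rfl fun τ _ => ?_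
  simp [twistCoeff]

lemma autPolar_expansion (σ : F ≃ₐ[ZMod 2] F) {A : F →ₗ[ZMod 2] F}
    {a : (F ≃ₐ[ZMod 2] F) → F} (hA : ∀ x, A x = ∑ τ, a τ * τ x) (x y : F) :
    autPolar σ (A x) (A y) =
      ∑ i, ∑ j, (twistCoeff σ a i * a j + a i * twistCoeff σ a j) * (i x * j y) := by
  rw [autPolar, apply_aut_expansion σ hA, apply_aut_expansion σ hA, hA, hA,
    Finset.sum_mul_sum, Finset.sum_mul_sum, ← Finset.sum_add_distrib]
  refine Finset.sum_congr rfl fun i _ => ?_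
  rw [← Finset.sum_add_distrib]
  exact Finset.sum_congr rfl fun j _ => by ring

/-- Proportional coefficients make the twisted map proportional to the map. -/
lemma apply_mul_comm_of_proportional (σ : F ≃ₐ[ZMod 2] F) {A : F →ₗ[ZMod 2] F}
    {a : (F ≃ₐ[ZMod 2] F) → F} (hA : ∀ x, A x = ∑ τ, a τ * τ x)
    (h : ∀ s t, twistCoeff σ a s * a t = twistCoeff σ a t * a s) (x y : F) :
    σ (A x) * A y = A x * σ (A y) := by
  rw [apply_aut_expansion σ hA, apply_aut_expansion σ hA, hA, hA,
    Finset.sum_mul_sum, Finset.sum_mul_sum]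
  refine Finset.sum_congr rfl fun i _ => Finset.sum_congr rfl fun j _ => ?_
  linear_combination i x * j y * h i j

end

variable [DecidableEq (F ≃ₐ[ZMod 2] F)]

/-- The coefficient of `p x * q y` in `i (autPolar κ x y)`. -/
def polarCoeff (κ i p q : F ≃ₐ[ZMod 2] F) : F :=
  (if κ * i = p then 1 else 0) * (if i = q then 1 else 0) +
    (if i = p then 1 else 0) * (if κ * i = q then 1 else 0)

lemma polarCoeff_eq_zero {κ i p q : F ≃ₐ[ZMod 2] F} (h₁ : p ≠ κ * q) (h₂ : q ≠ κ * p) :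
    polarCoeff κ i p q = 0 := by
  unfold polarCoeff
  split_ifs with h3 h4 h5 h6 h5 h6 <;> simp_all

/-- An edge {p, κp} has a unique starting point because κ² ≠ 1, so testing at an edge isolates a
single coefficient. -/
lemma polarCoeff_step {κ : F ≃ₐ[ZMod 2] F} (hκ : κ * κ ≠ 1) (i p : F ≃ₐ[ZMod 2] F) :
    polarCoeff κ i p (κ * p) = if i = p then 1 else 0 := by
  unfold polarCoeff
  have : ¬ (κ * i = p ∧ i = κ * p) := by
    rintro ⟨h, rfl⟩
    rw [← mul_assoc] at h
    exact hκ (by simpa using h)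
  by_cases h : i = p
  · subst h
    have : κ * i ≠ i ∨ i ≠ κ * i := by tauto
    rcases this with h | h <;> simp [h]
  · simp only [h, if_false, mul_left_cancel_iff, zero_mul, add_zero]
    by_cases h1 : κ * i = p <;> by_cases h2 : i = κ * p <;> simp_all

variable [Fintype F] {e : (F ≃ₐ[ZMod 2] F) → F → F}

lemma extract_mul (he : ∀ σ τ : F ≃ₐ[ZMod 2] F, ∑ x, e σ x * τ x = if τ = σ then 1 else 0)
    (p q i j : F ≃ₐ[ZMod 2] F) :
    ∑ x, ∑ y, e p x * e q y * (i x * j y) =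
      (if i = p then 1 else 0) * (if j = q then 1 else 0) := by
  rw [← he, ← he, Finset.sum_mul_sum]
  exact Finset.sum_congr rfl fun x _ => Finset.sum_congr rfl fun y _ => by ring

lemma extract_autPolar
    (he : ∀ σ τ : F ≃ₐ[ZMod 2] F, ∑ x, e σ x * τ x = if τ = σ then 1 else 0)
    (κ p q i : F ≃ₐ[ZMod 2] F) :
    ∑ x, ∑ y, e p x * e q y * i (autPolar κ x y) = polarCoeff κ i p q := by
  rw [polarCoeff, ← extract_mul he, ← extract_mul he, ← Finset.sum_add_distrib]
  refine Finset.sum_congr rfl fun x _ => ?_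
  rw [← Finset.sum_add_distrib]
  refine Finset.sum_congr rfl fun y _ => ?_
  simp only [autPolar, map_add, map_mul, AlgEquiv.mul_apply, aut_comm i κ]
  ring

lemma extract_linear_autPolar
    (he : ∀ σ τ : F ≃ₐ[ZMod 2] F, ∑ x, e σ x * τ x = if τ = σ then 1 else 0)
    {M : F →ₗ[ZMod 2] F} {c : (F ≃ₐ[ZMod 2] F) → F} (hM : ∀ x, M x = ∑ τ, c τ * τ x)
    (κ p q : F ≃ₐ[ZMod 2] F) :
    ∑ x, ∑ y, e p x * e q y * M (autPolar κ x y) = ∑ i, c i * polarCoeff κ i p q := by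
  simp only [← extract_autPolar he, hM, Finset.mul_sum]
  rw [Finset.sum_congr rfl fun x _ => Finset.sum_comm, Finset.sum_comm]
  refine Finset.sum_congr rfl fun i _ => Finset.sum_congr rfl fun x _ =>
    Finset.sum_congr rfl fun y _ => ?_
  ring

lemma extract_bilinear
    (he : ∀ σ τ : F ≃ₐ[ZMod 2] F, ∑ x, e σ x * τ x = if τ = σ then 1 else 0)
    (c : (F ≃ₐ[ZMod 2] F) → (F ≃ₐ[ZMod 2] F) → F) (p q : F ≃ₐ[ZMod 2] F) :
    ∑ x, ∑ y, e p x * e q y * (∑ i, ∑ j, c i j * (i x * j y)) = c p q := by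
  have h : ∑ x, ∑ y, e p x * e q y * (∑ i, ∑ j, c i j * (i x * j y)) =
      ∑ i, ∑ j, c i j * ∑ x, ∑ y, e p x * e q y * (i x * j y) := by
    simp only [Finset.mul_sum]
    rw [Finset.sum_congr rfl fun x _ => Finset.sum_comm, Finset.sum_comm]
    refine Finset.sum_congr rfl fun i _ => ?_
    rw [Finset.sum_congr rfl fun x _ => Finset.sum_comm, Finset.sum_comm]
    refine Finset.sum_congr rfl fun j _ => Finset.sum_congr rfl fun x _ =>
      Finset.sum_congr rfl fun y _ => ?_
    ring
  rw [h]
  simp only [extract_mul he]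
  simp

/-- Extraction of a coefficient of a form in four variables that depends on two polar values. -/
lemma extract_quadrilinear
    (he : ∀ σ τ : F ≃ₐ[ZMod 2] F, ∑ x, e σ x * τ x = if τ = σ then 1 else 0)
    (κ : F ≃ₐ[ZMod 2] F) (c : (F ≃ₐ[ZMod 2] F) → (F ≃ₐ[ZMod 2] F) → F)
    (p q r s : F ≃ₐ[ZMod 2] F) :
    ∑ x, ∑ y, ∑ z, ∑ w, e p x * e q y * (e r z * e s w) *
        (∑ i, ∑ j, c i j * (i (autPolar κ x y) * j (autPolar κ z w))) =
      ∑ i, ∑ j, c i j * (polarCoeff κ i p q * polarCoeff κ j r s) := by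
  have h (i j : F ≃ₐ[ZMod 2] F) : polarCoeff κ i p q * polarCoeff κ j r s =
      ∑ x, ∑ y, ∑ z, ∑ w, e p x * e q y * (e r z * e s w) *
        (i (autPolar κ x y) * j (autPolar κ z w)) := by
    rw [← extract_autPolar he, ← extract_autPolar he, Finset.sum_mul]
    refine Finset.sum_congr rfl fun x _ => ?_
    rw [Finset.sum_mul]
    refine Finset.sum_congr rfl fun y _ => ?_
    rw [Finset.mul_sum]
    refine Finset.sum_congr rfl fun z _ => ?_
    rw [Finset.mul_sum]
    exact Finset.sum_congr rfl fun w _ => by ring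
  simp only [h, Finset.mul_sum]
  simp only [← Finset.sum_product', Finset.univ_product_univ]
  -- The bijection moves the indices i, j in front of the four field variables.
  exact Fintype.sum_equiv
    ⟨fun v => (v.2.2.2.2.1, v.2.2.2.2.2, v.1, v.2.1, v.2.2.1, v.2.2.2.1),
      fun v => (v.2.2.1, v.2.2.2.1, v.2.2.2.2.1, v.2.2.2.2.2, v.1, v.2.1),
      fun _ => rfl, fun _ => rfl⟩ _ _ fun v => by simp only [Equiv.coe_fn_mk]; ring

end Polar

/-! ### Successive polarizations of the graph identity. -/

section Polarization

variable {F : Type*} [Field F] [Algebra (ZMod 2) F] {κ lam : F ≃ₐ[ZMod 2] F}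

lemma autPolar_comm (σ : F ≃ₐ[ZMod 2] F) (x y : F) : autPolar σ x y = autPolar σ y x := by
  simp only [autPolar]; ring

lemma autPolar_add_left (σ : F ≃ₐ[ZMod 2] F) (x y z : F) :
    autPolar σ (x + y) z = autPolar σ x z + autPolar σ y z := by
  simp only [autPolar, map_add]; ring

lemma autPolar_add_right (σ : F ≃ₐ[ZMod 2] F) (x y z : F) :
    autPolar σ x (y + z) = autPolar σ x y + autPolar σ x z := by
  simp only [autPolar, map_add]; ring

lemma aut_quadratic_add (σ : F ≃ₐ[ZMod 2] F) (x y : F) :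
    σ (x + y) * (x + y) = σ x * x + σ y * y + autPolar σ x y := by
  simp only [autPolar, map_add]; ring

variable {A B A' B' : F →ₗ[ZMod 2] F}

lemma map_add_gold (A B : F →ₗ[ZMod 2] F) (x y : F) :
    A (x + y) + B (κ (x + y) * (x + y)) =
      (A x + B (κ x * x)) + (A y + B (κ y * y)) + B (autPolar κ x y) := by
  rw [aut_quadratic_add]
  simp only [map_add]
  ring

lemma second_polarization
    (h : ∀ x, lam (A x + B (κ x * x)) * (A x + B (κ x * x)) = A' x + B' (κ x * x)) (x y : F) :
    lam (B (autPolar κ x y)) * B (autPolar κ x y) +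
      autPolar lam (A x + B (κ x * x)) (A y + B (κ y * y)) +
      autPolar lam ((A x + B (κ x * x)) + (A y + B (κ y * y))) (B (autPolar κ x y)) =
    B' (autPolar κ x y) := by
  have e := h (x + y)
  rw [map_add_gold, map_add_gold, aut_quadratic_add, aut_quadratic_add] at e
  linear_combination e - h x - h y

/-- The right side of `second_polarization` is additive in x, so it cancels here; A survives, which
the rank-one case needs. -/
lemma third_polarization
    (h : ∀ x, lam (A x + B (κ x * x)) * (A x + B (κ x * x)) = A' x + B' (κ x * x)) (x y z : F) :
    autPolar lam (A x + B (κ x * x)) (B (autPolar κ y z)) +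
      autPolar lam (A y + B (κ y * y)) (B (autPolar κ x z)) +
      autPolar lam (A z + B (κ z * z)) (B (autPolar κ x y)) +
      (autPolar lam (B (autPolar κ x y)) (B (autPolar κ y z)) +
      autPolar lam (B (autPolar κ x y)) (B (autPolar κ x z)) +
      autPolar lam (B (autPolar κ x z)) (B (autPolar κ y z))) = 0 := by
  have e := second_polarization h (x + z) y
  have e₁ := second_polarization h x y
  have e₂ := second_polarization h z y
  rw [map_add_gold, autPolar_add_left κ, map_add B, map_add B', aut_quadratic_add] at e
  rw [autPolar_comm κ z y] at e e₂
  simp only [autPolar_add_left lam, autPolar_add_right lam] at e e₁ e₂ ⊢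
  linear_combination e - e₁ - e₂ + autPolar_comm lam (A y) (B (autPolar κ x z)) +
    autPolar_comm lam (B (κ y * y)) (B (autPolar κ x z)) +
    autPolar_comm lam (B (autPolar κ x y)) (B (autPolar κ x z))

/-- Only the quartic part lam(B q) * B q with q = κ x * x survives, as a sum over the three pairings
of four variables. -/
lemma fourth_polarization
    (h : ∀ x, lam (A x + B (κ x * x)) * (A x + B (κ x * x)) = A' x + B' (κ x * x))
    (x y z w : F) :
    autPolar lam (B (autPolar κ x y)) (B (autPolar κ z w)) +
      autPolar lam (B (autPolar κ x z)) (B (autPolar κ y w)) +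
      autPolar lam (B (autPolar κ x w)) (B (autPolar κ y z)) = 0 := by
  have e := third_polarization h (x + w) y z
  have e₁ := third_polarization h x y z
  have e₂ := third_polarization h w y z
  rw [map_add_gold] at e
  simp only [autPolar_add_left κ, map_add B] at e e₁ e₂
  simp only [autPolar_add_left lam, autPolar_add_right lam] at e e₁ e₂ ⊢
  rw [autPolar_comm κ z w, autPolar_comm κ y w]
  linear_combination e - e₁ - e₂ +
    autPolar_comm lam (B (autPolar κ x z)) (B (autPolar κ w y))

end Polarization

/-! ### Proportionality from polarized identities. -/

section Coefficients

variable {F : Type*} [Field F] [Finite F] [Algebra (ZMod 2) F] {κ lam : F ≃ₐ[ZMod 2] F}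

lemma charP_two_of_algebra (F : Type*) [Field F] [Algebra (ZMod 2) F] : CharP F 2 :=
  charP_of_injective_algebraMap (algebraMap (ZMod 2) F).injective 2

/-- A linear map that vanishes on all polar values is zero. -/
lemma eq_zero_of_apply_autPolar_eq_zero (hκ : κ * κ ≠ 1) {M : F →ₗ[ZMod 2] F}
    (h : ∀ x y, M (autPolar κ x y) = 0) : M = 0 := by
  classical
  have := Fintype.ofFinite F
  obtain ⟨e, he⟩ := exists_extraction_weights (F := F)
  obtain ⟨c, hc⟩ := exists_aut_expansion M
  have hc0 (i : F ≃ₐ[ZMod 2] F) : c i = 0 := by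
    have := extract_linear_autPolar he hc κ i (κ * i)
    simpa [h, polarCoeff_step hκ] using this.symm
  ext x
  simp [hc, hc0]

/-- Coefficients of a map whose image carries a form pulled back from the polar form of `κ`. -/
lemma proportional_of_autPolar_eq {A M : F →ₗ[ZMod 2] F}
    (h : ∀ x y, autPolar lam (A x) (A y) = M (autPolar κ x y))
    {a : (F ≃ₐ[ZMod 2] F) → F} (ha : ∀ x, A x = ∑ τ, a τ * τ x) (s t : F ≃ₐ[ZMod 2] F)
    (hs : s ≠ κ * t) (ht : t ≠ κ * s) :
    twistCoeff lam a s * a t = twistCoeff lam a t * a s := by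
  classical
  have := Fintype.ofFinite F
  have := charP_two_of_algebra F
  obtain ⟨e, he⟩ := exists_extraction_weights (F := F)
  obtain ⟨c, hc⟩ := exists_aut_expansion M
  have h1 := extract_linear_autPolar he hc κ s t
  simp only [← h, autPolar_expansion lam ha, extract_bilinear he, polarCoeff_eq_zero hs ht,
    mul_zero, Finset.sum_const_zero] at h1
  rw [CharTwo.add_eq_zero] at h1
  rw [h1, mul_comm]

/-- Coefficients of a map for which the symmetrized product of polar values vanishes. -/
lemma proportional_of_quadrilinear (h5 : 5 ≤ orderOf κ) {B : F →ₗ[ZMod 2] F}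
    (h : ∀ x y z w, autPolar lam (B (autPolar κ x y)) (B (autPolar κ z w)) +
      autPolar lam (B (autPolar κ x z)) (B (autPolar κ y w)) +
      autPolar lam (B (autPolar κ x w)) (B (autPolar κ y z)) = 0)
    {b : (F ≃ₐ[ZMod 2] F) → F} (hb : ∀ x, B x = ∑ τ, b τ * τ x) (s t : F ≃ₐ[ZMod 2] F)
    (hst : s ≠ t) (hs : s ≠ κ * t) (ht : t ≠ κ * s) :
    twistCoeff lam b s * b t = twistCoeff lam b t * b s := by
  classical
  have := Fintype.ofFinite F
  have := charP_two_of_algebra F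
  have h2 : κ * κ ≠ 1 := by
    simpa [pow_succ] using pow_ne_one_of_lt_orderOf (x := κ) (n := 2) (by norm_num) (by omega)
  have h4 : κ * (κ * (κ * κ)) ≠ 1 := by
    simpa [pow_succ, mul_assoc] using
      pow_ne_one_of_lt_orderOf (x := κ) (n := 4) (by norm_num) (by omega)
  obtain ⟨e, he⟩ := exists_extraction_weights (F := F)
  simp only [autPolar_expansion lam hb] at h
  -- The coefficient of s(x) * κs(y) * t(z) * κt(w) is compared. Only the pairing {s, κs}, {t, κt}
  -- consists of two edges.
  have e₁ := extract_quadrilinear he κ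
    (fun i j => twistCoeff lam b i * b j + b i * twistCoeff lam b j) s (κ * s) t (κ * t)
  have e₂ := extract_quadrilinear he κ
    (fun i j => twistCoeff lam b i * b j + b i * twistCoeff lam b j) s t (κ * s) (κ * t)
  have e₃ := extract_quadrilinear he κ
    (fun i j => twistCoeff lam b i * b j + b i * twistCoeff lam b j) s (κ * t) (κ * s) t
  have r₁ : ∑ i, ∑ j, (twistCoeff lam b i * b j + b i * twistCoeff lam b j) *
      (polarCoeff κ i s (κ * s) * polarCoeff κ j t (κ * t)) =
      twistCoeff lam b s * b t + b s * twistCoeff lam b t := by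
    simp [polarCoeff_step h2]
  have r₂ : ∑ i, ∑ j, (twistCoeff lam b i * b j + b i * twistCoeff lam b j) *
      (polarCoeff κ i s t * polarCoeff κ j (κ * s) (κ * t)) = 0 := by
    simp [polarCoeff_eq_zero hs ht]
  have r₃ : ∑ i, ∑ j, (twistCoeff lam b i * b j + b i * twistCoeff lam b j) *
      (polarCoeff κ i s (κ * t) * polarCoeff κ j (κ * s) t) = 0 := by
    refine Finset.sum_eq_zero fun i _ => Finset.sum_eq_zero fun j _ => ?_
    -- As s ≠ t, both {s, κt} and {κs, t} are edges only if s = κ²t and t = κ²s, which would give κ⁴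
    -- = 1.
    by_cases h1 : s = κ * (κ * t)
    · have : polarCoeff κ j (κ * s) t = 0 := by
        apply polarCoeff_eq_zero
        · simpa using hst
        · intro h'
          apply h4
          have : (κ * (κ * (κ * κ))) * t = t := by
            simp only [mul_assoc]
            rw [← h1]
            exact h'.symm
          simpa using this
      rw [this, mul_zero, mul_zero]
    · rw [polarCoeff_eq_zero h1 (by simpa using hst.symm), zero_mul, mul_zero]
  rw [r₁] at e₁
  rw [r₂] at e₂
  rw [r₃] at e₃
  have hsum : twistCoeff lam b s * b t + b s * twistCoeff lam b t + 0 + 0 = 0 := by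
    rw [Finset.sum_congr rfl fun x _ => Finset.sum_comm] at e₂
    rw [Finset.sum_congr rfl fun x _ => Finset.sum_comm,
      Finset.sum_congr rfl fun x _ => Finset.sum_congr rfl fun y _ => Finset.sum_comm] at e₃
    refine (congrArg₂ (· + ·) (congrArg₂ (· + ·) e₁ e₂) e₃).symm.trans ?_
    simp only [← Finset.sum_add_distrib]
    refine Finset.sum_eq_zero fun x _ => Finset.sum_eq_zero fun y _ =>
      Finset.sum_eq_zero fun z _ => Finset.sum_eq_zero fun w _ => ?_
    linear_combination e s x * e (κ * s) y * (e t z * e (κ * t) w) * h x y z w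
  rw [add_zero, add_zero, CharTwo.add_eq_zero] at hsum
  rw [hsum, mul_comm]

end Coefficients

/-! ### Rank-one maps and the bound on the field. -/

section Rank

variable {F : Type*} [Field F] [Finite F] [Algebra (ZMod 2) F] {κ lam : F ≃ₐ[ZMod 2] F}

/-- If `lam` generates the Galois group, `lam u * v = u * lam v` forces `u`, `v` to be
`𝔽₂`-proportional. -/
lemma eq_zero_or_eq_of_aut_mul_comm (hlam : ∀ σ, σ ∈ Subgroup.zpowers lam) {u v : F}
    (hu : u ≠ 0) (h : lam v * u = v * lam u) : v = 0 ∨ v = u := by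
  have hu' : lam u ≠ 0 := by simpa using hu
  have : lam (v / u) = v / u := by
    rw [map_div₀, div_eq_div_iff hu' hu, h]
  rcases eq_zero_or_one_of_fixed hlam this with h0 | h1
  · exact Or.inl ((div_eq_zero_iff.1 h0).resolve_right hu)
  · exact Or.inr ((div_eq_one_iff_eq hu).1 h1)

/-- If the values of `B` are pairwise `lam`-proportional and `B` is nonzero, the third
polarization bounds the size of the field. -/
lemma card_le_of_third_polarization (hlam : ∀ σ, σ ∈ Subgroup.zpowers lam) {P : F → F}
    (hP : Function.Surjective P) {B : F →ₗ[ZMod 2] F}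
    (hB : ∀ x y, lam (B x) * B y = B x * lam (B y))
    (h : ∀ x y z, autPolar lam (P x) (B (autPolar κ y z)) +
      autPolar lam (P y) (B (autPolar κ x z)) +
      autPolar lam (P z) (B (autPolar κ x y)) = 0)
    {x₀ y₀ : F} (hd : B (autPolar κ x₀ y₀) ≠ 0) : Nat.card F ≤ 8 := by
  classical
  have := Fintype.ofFinite F
  have := charP_two_of_algebra F
  set d := B (autPolar κ x₀ y₀) with hd'
  have hBd (v : F) : B v = 0 ∨ B v = d :=
    eq_zero_or_eq_of_aut_mul_comm hlam hd (hB _ _)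
  set S : Finset F := {0, autPolar lam (P x₀) d, autPolar lam (P y₀) d,
    autPolar lam (P x₀) d + autPolar lam (P y₀) d} with hS
  have hScard : S.card ≤ 4 := Finset.card_le_four
  -- With v = P z, the identity at x₀, y₀, z expresses this value through two terms, each with
  -- B-value 0 or d.
  have hmem (v : F) : autPolar lam v d ∈ S := by
    obtain ⟨z, rfl⟩ := hP v
    have hz := h x₀ y₀ z
    rw [← hd', CharTwo.add_eq_zero] at hz
    rw [← hz, hS]
    have h0 (w : F) : autPolar lam w 0 = 0 := by simp [autPolar]
    rcases hBd (autPolar κ y₀ z) with e₁ | e₁ <;> rcases hBd (autPolar κ x₀ z) with e₂ | e₂ <;>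
      simp [e₁, e₂, h0]
  -- A fibre is contained in a coset of the kernel {0, d}; four values then give |F| ≤ 8.
  have hfib (s : F) : (Finset.univ.filter fun v => autPolar lam v d = s).card ≤ 2 := by
    by_cases hne : (Finset.univ.filter fun v => autPolar lam v d = s).Nonempty
    · obtain ⟨v₀, hv₀⟩ := hne
      have hv₀' : autPolar lam v₀ d = s := by simpa using hv₀
      refine (Finset.card_le_card (t := {v₀, v₀ + d}) fun v hv => ?_).trans Finset.card_le_two
      have hv' : autPolar lam v d = s := by simpa using hv
      have hk : lam (v + v₀) * d = (v + v₀) * lam d := by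
        rw [← CharTwo.add_eq_zero]
        change autPolar lam (v + v₀) d = 0
        rw [autPolar_add_left, hv', hv₀', CharTwo.add_self_eq_zero]
      rcases eq_zero_or_eq_of_aut_mul_comm hlam hd hk with h0 | h1
      · simp [CharTwo.add_eq_zero.1 h0]
      · have : v = v₀ + d := by
          rw [← h1, add_comm v, ← add_assoc, CharTwo.add_self_eq_zero, zero_add]
        simp [this]
    · simp [Finset.not_nonempty_iff_eq_empty.1 hne]
  rw [Nat.card_eq_fintype_card, ← Finset.card_univ]
  have := Finset.card_le_mul_card_image_of_maps_to (s := Finset.univ) (t := S)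
    (f := fun v => autPolar lam v d) (fun v _ => hmem v) 2 (fun s _ => hfib s)
  omega

end Rank

/-! ### Gold functions and their equivalences. -/

section Gold

variable {F : Type*} [Field F] [Finite F] [Algebra (ZMod 2) F]

/-- The automorphism `x ↦ x ^ (2 ^ k)`. -/
noncomputable def frobPow (F : Type*) [Field F] [Finite F] [Algebra (ZMod 2) F] (k : ℕ) :
    F ≃ₐ[ZMod 2] F :=
  FiniteField.frobeniusAlgEquivOfAlgebraic (ZMod 2) F ^ k

lemma frobPow_apply (k : ℕ) (x : F) : frobPow F k x = x ^ 2 ^ k := by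
  induction k generalizing x with
  | zero => simp [frobPow]
  | succ k ih =>
    have : frobPow F (k + 1) x =
        frobPow F k (FiniteField.frobeniusAlgEquivOfAlgebraic (ZMod 2) F x) := by
      rw [frobPow, pow_succ]; rfl
    rw [this, ih, FiniteField.coe_frobeniusAlgEquivOfAlgebraic, ZMod.card]
    simp only
    rw [← pow_mul, ← pow_succ']

lemma goldFunction_eq (k : ℕ) (x : F) : goldFunction F k x = frobPow F k x * x := by
  rw [goldFunction, frobPow_apply, pow_succ]

lemma finrank_eq_of_card {m : ℕ} (hF : Nat.card F = 2 ^ m) : Module.finrank (ZMod 2) F = m := by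
  have h := Module.natCard_eq_pow_finrank (K := ZMod 2) (V := F)
  rw [hF, Nat.card_zmod] at h
  exact (Nat.pow_right_injective le_rfl h).symm

lemma orderOf_frobPow_one {m : ℕ} (hF : Nat.card F = 2 ^ m) :
    orderOf (FiniteField.frobeniusAlgEquivOfAlgebraic (ZMod 2) F) = m := by
  rw [FiniteField.orderOf_frobeniusAlgEquivOfAlgebraic, finrank_eq_of_card hF]

lemma orderOf_frobPow {m k : ℕ} (hF : Nat.card F = 2 ^ m) (hk : k.Coprime m) :
    orderOf (frobPow F k) = m := by
  rw [frobPow, Nat.Coprime.orderOf_pow (by rw [orderOf_frobPow_one hF]; exact hk.symm),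
    orderOf_frobPow_one hF]

lemma frobPow_generates {m k : ℕ} (hF : Nat.card F = 2 ^ m) (hk : k.Coprime m)
    (σ : F ≃ₐ[ZMod 2] F) : σ ∈ Subgroup.zpowers (frobPow F k) := by
  have h : Subgroup.zpowers (frobPow F k) = ⊤ := Subgroup.eq_top_of_card_eq _ <| by
    rw [Nat.card_zpowers, orderOf_frobPow hF hk, IsGalois.card_aut_eq_finrank,
      finrank_eq_of_card hF]
  exact h ▸ Subgroup.mem_top σ

lemma frobPow_ne {m k l : ℕ} (hF : Nat.card F = 2 ^ m) (hk : k < m) (hl : l < m) (h : l ≠ k) :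
    frobPow F l ≠ frobPow F k := by
  intro h'
  exact h (pow_injOn_Iio_orderOf (by rw [orderOf_frobPow_one hF]; exact hl)
    (by rw [orderOf_frobPow_one hF]; exact hk) h')

/-- The bound by m/2 enters here: it excludes lam = κ⁻¹ and, for l = k, an involution κ. -/
lemma frobPow_mul_ne_one {m k l : ℕ} (hF : Nat.card F = 2 ^ m) (hk : 0 < k) (hkl : k + l < m) :
    frobPow F k * frobPow F l ≠ 1 := by
  rw [frobPow, frobPow, ← pow_add]
  exact pow_ne_one_of_lt_orderOf (by omega) (by rwa [orderOf_frobPow_one hF])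

/-- A CCZ-equivalence between Gold functions, written with linear maps. -/
lemma CCZEquivalent.exists_linearMaps {k l : ℕ}
    (h : CCZEquivalent (goldFunction F k) (goldFunction F l)) :
    ∃ A B A' B' : F →ₗ[ZMod 2] F,
      Function.Surjective (fun x => A x + B (frobPow F k x * x)) ∧
      ∀ x, frobPow F l (A x + B (frobPow F k x * x)) * (A x + B (frobPow F k x * x)) =
        A' x + B' (frobPow F k x * x) := by
  obtain ⟨C, hC⟩ := h
  set κ := frobPow F k
  set lam := frobPow F l
  let T : F × F →ₗ[ZMod 2] F × F := C.linear
  set A : F →ₗ[ZMod 2] F := LinearMap.fst _ _ _ ∘ₗ T ∘ₗ LinearMap.inl _ _ _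
  set B : F →ₗ[ZMod 2] F := LinearMap.fst _ _ _ ∘ₗ T ∘ₗ LinearMap.inr _ _ _
  set A₂ : F →ₗ[ZMod 2] F := LinearMap.snd _ _ _ ∘ₗ T ∘ₗ LinearMap.inl _ _ _
  set B₂ : F →ₗ[ZMod 2] F := LinearMap.snd _ _ _ ∘ₗ T ∘ₗ LinearMap.inr _ _ _
  set c := C 0
  have hdec (x y : F) : C (x, y) = (A x + B y + c.1, A₂ x + B₂ y + c.2) := by
    have h1 : C (x, y) = T (x, y) + c := by
      have h : C (x, y) = C.linear (x, y) + C 0 := by simpa using C.map_vadd 0 (x, y)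
      exact h
    have h2 : T (x, y) = T (x, 0) + T (0, y) := by rw [← map_add]; simp
    rw [h1, h2]
    rfl
  have hgraph (x : F) : lam (A x + B (κ x * x) + c.1) * (A x + B (κ x * x) + c.1) =
      A₂ x + B₂ (κ x * x) + c.2 := by
    have : C (x, κ x * x) ∈ functionGraph (goldFunction F l) := by
      rw [← hC]
      exact ⟨_, by simp [functionGraph, goldFunction_eq, κ], rfl⟩
    rw [hdec] at this
    simp only [functionGraph, Set.mem_ofPred_eq, goldFunction_eq] at this
    exact this.symm
  have hc : lam c.1 * c.1 = c.2 := by simpa using hgraph 0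
  -- Translating by c.1 changes the quadratic map u ↦ lam u * u by the constant c.2 and this linear
  -- term, which A' and B' absorb.
  let D : F →ₗ[ZMod 2] F :=
    (AddMonoidHom.mk' (fun u => autPolar lam u c.1)
      fun u v => autPolar_add_left lam u v c.1).toZModLinearMap 2
  have hD (u : F) : D u = autPolar lam u c.1 := rfl
  refine ⟨A, B, A₂ - D ∘ₗ A, B₂ - D ∘ₗ B, fun z => ?_, fun x => ?_⟩
  · have : (z + c.1, goldFunction F l (z + c.1)) ∈ C '' functionGraph (goldFunction F k) := by
      rw [hC]; rfl
    obtain ⟨⟨x, y⟩, hxy, he⟩ := this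
    have hy : y = κ x * x := hxy.trans (goldFunction_eq k x)
    rw [hdec, Prod.mk.injEq] at he
    refine ⟨x, ?_⟩
    have := he.1
    rw [hy] at this
    exact add_right_cancel this
  · have := hgraph x
    rw [aut_quadratic_add, hc] at this
    simp only [LinearMap.sub_apply, LinearMap.comp_apply, hD]
    rw [autPolar_add_left] at this
    linear_combination this

/-- Gold functions with distinct parameters below `m / 2` are not CCZ-equivalent. -/
theorem not_cczEquivalent_gold {m k l : ℕ} (hm : 5 ≤ m) (hF : Nat.card F = 2 ^ m)
    (hk : 0 < k) (hkm : 2 * k < m) (hkc : k.Coprime m) (hlm : 2 * l < m) (hlc : l.Coprime m)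
    (hkl : l ≠ k) : ¬ CCZEquivalent (goldFunction F k) (goldFunction F l) := by
  intro h
  obtain ⟨A, B, A', B', hsurj, hid⟩ := h.exists_linearMaps
  have hκ := frobPow_generates hF hkc
  have hlam := frobPow_generates hF hlc
  have h5 : 5 ≤ orderOf (frobPow F k) := by rwa [orderOf_frobPow hF hkc]
  have hne := frobPow_ne hF (k := k) (l := l) (by omega) (by omega) hkl
  have hne' := frobPow_mul_ne_one hF (k := k) (l := l) hk (by omega)
  have hκ2 : frobPow F k * frobPow F k ≠ 1 := frobPow_mul_ne_one hF hk (by omega)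
  have hcard : 32 ≤ Nat.card F := by
    rw [hF]
    exact Nat.pow_le_pow_right (n := 2) (by norm_num) hm
  obtain ⟨b, hb⟩ := exists_aut_expansion B
  have hprop := proportional_twist hκ hlam h5 hne hne' (eq_zero_of_twistCoeff _ b)
    (proportional_of_quadrilinear h5 (fourth_polarization hid) hb)
  have hBB := apply_mul_comm_of_proportional _ hb hprop
  have := charP_two_of_algebra F
  have hBB' (x y : F) : autPolar (frobPow F l) (B x) (B y) = 0 := by
    rw [autPolar, hBB, CharTwo.add_self_eq_zero]
  by_cases hB0 : ∀ x y, B (autPolar (frobPow F k) x y) = 0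
  · obtain rfl := eq_zero_of_apply_autPolar_eq_zero hκ2 hB0
    have h2 := second_polarization hid
    simp only [LinearMap.zero_apply, add_zero, map_zero, mul_zero, zero_add] at h2 hsurj
    obtain ⟨a, ha⟩ := exists_aut_expansion A
    have hpropA := proportional_twist hκ hlam h5 hne hne' (eq_zero_of_twistCoeff _ a)
      fun s t _ => proportional_of_autPolar_eq (by simpa [autPolar] using h2) ha s t
    have hAA := apply_mul_comm_of_proportional _ ha hpropA
    obtain ⟨x₁, hx₁⟩ := hsurj 1
    have hall (v : F) : v = 0 ∨ v = 1 := by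
      obtain ⟨x, rfl⟩ := hsurj v
      refine eq_zero_or_eq_of_aut_mul_comm hlam one_ne_zero ?_
      have := hAA x x₁
      have hx₁' : A x₁ = 1 := hx₁
      rwa [hx₁'] at this
    have : Nat.card F ≤ 2 := by
      classical
      have := Fintype.ofFinite F
      rw [Nat.card_eq_fintype_card, ← Finset.card_univ]
      exact (Finset.card_le_card (t := {0, 1}) fun v _ => by simpa using hall v).trans
        Finset.card_le_two
    omega
  · push Not at hB0
    obtain ⟨x₀, y₀, hd⟩ := hB0
    have h3 := third_polarization hid
    simp only [hBB', add_zero] at h3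
    have := card_le_of_third_polarization hlam hsurj hBB h3 hd
    omega

/-- The linear maps `L`, `N` with `f ∘ L = N ∘ f` for the Gold function `f`. -/
theorem exists_of_gold_comp_eq {m k : ℕ} (hm : 5 ≤ m) (hF : Nat.card F = 2 ^ m)
    (hk : 0 < k) (hkm : 2 * k < m) (hkc : k.Coprime m) {L N : F →ₗ[ZMod 2] F}
    (h : ∀ x, frobPow F k (L x) * L x = N (frobPow F k x * x)) :
    ∃ (a : F) (u : ℕ), u < m ∧ (∀ x, L x = a * x ^ 2 ^ u) ∧
      ∀ x, N x = a ^ (2 ^ k + 1) * x ^ 2 ^ u := by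
  have hκ := frobPow_generates hF hkc
  have h5 : 5 ≤ orderOf (frobPow F k) := by rwa [orderOf_frobPow hF hkc]
  have hκ2 : frobPow F k * frobPow F k ≠ 1 := frobPow_mul_ne_one hF hk (by omega)
  have := charP_two_of_algebra F
  have hpol (x y : F) : autPolar (frobPow F k) (L x) (L y) = N (autPolar (frobPow F k) x y) := by
    have e := h (x + y)
    rw [map_add, aut_quadratic_add, aut_quadratic_add, map_add, map_add] at e
    linear_combination e - h x - h y
  obtain ⟨c, hc⟩ := exists_aut_expansion L
  have hprop := proportional_of_autPolar_eq hpol hc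
  have hshape : ∃ (a : F) (s : F ≃ₐ[ZMod 2] F), ∀ x, L x = a * s x := by
    rcases ne_zero_or_support_subsingleton h5 hκ (eq_zero_of_twistCoeff _ c)
      (fun s t _ => hprop s t) with hne | ⟨s, hs⟩
    · have hLL := apply_mul_comm_of_proportional _ hc
        (proportional_of_offCycle hκ h5 hne fun s t _ => hprop s t)
      have hN : N = 0 := eq_zero_of_apply_autPolar_eq_zero hκ2 fun x y => by
        rw [← hpol, autPolar, hLL, CharTwo.add_self_eq_zero]
      -- N = 0 forces L = 0, so any automorphism serves with coefficient 0.
      refine ⟨0, 1, fun x => ?_⟩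
      have := h x
      simpa [hN] using this
    · classical
      refine ⟨c s, s, fun x => ?_⟩
      rw [hc, Finset.sum_eq_single s (fun t _ ht => by rw [hs t ht, zero_mul]) (by simp)]
  obtain ⟨a, s, hL⟩ := hshape
  obtain ⟨u, hu⟩ := (FiniteField.bijective_frobeniusAlgEquivOfAlgebraic_pow (ZMod 2) F).2 s
  have hs (x : F) : s x = x ^ 2 ^ (u : ℕ) := by
    rw [← frobPow_apply, frobPow, ← hu]
  refine ⟨a, u, u.2.trans_eq (finrank_eq_of_card hF), fun x => by rw [hL, hs], fun x => ?_⟩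
  let M : F →ₗ[ZMod 2] F := LinearMap.mulLeft (ZMod 2) (a ^ (2 ^ k + 1)) ∘ₗ s.toLinearMap
  have hM (y : F) : M y = a ^ (2 ^ k + 1) * s y := rfl
  -- N and M agree on all polar values, and these detect linear maps.
  have hNM : N - M = 0 := eq_zero_of_apply_autPolar_eq_zero hκ2 fun y z => by
    rw [LinearMap.sub_apply, ← hpol, hL, hL, hM, autPolar, autPolar]
    simp only [map_add, map_mul, map_pow, frobPow_apply]
    ring
  rw [sub_eq_zero.1 hNM, hM, hs]

end Gold

/-! ### From linear maps back to linearized polynomials. -/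

section Linearized

open Polynomial

variable {F : Type*} [Field F] [Finite F]

lemma IsLinearizedPoly.exists_linearMap [Algebra (ZMod 2) F] {L : F[X]} (hL : IsLinearizedPoly L) :
    ∃ A : F →ₗ[ZMod 2] F, ∀ x, A x = L.eval x := by
  refine ⟨(AddMonoidHom.mk' (fun x => L.eval x) fun x y => ?_).toZModLinearMap 2, fun x => rfl⟩
  simp only [eval_eq_sum, Polynomial.sum, ← Finset.sum_add_distrib]
  refine Finset.sum_congr rfl fun n hn => ?_
  obtain ⟨i, rfl⟩ := hL n (mem_support_iff.1 hn)
  rw [← frobPow_apply, ← frobPow_apply, ← frobPow_apply, map_add, mul_add]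

/-- Polynomials of degree below |F| are determined by their values. -/
lemma eq_C_mul_X_pow_of_eval {m : ℕ} (hF : Nat.card F = 2 ^ m) {L : F[X]}
    (hL : L.natDegree < 2 ^ m) {a : F} {u : ℕ} (hu : u < m)
    (h : ∀ x, L.eval x = a * x ^ 2 ^ u) : L = C a * X ^ 2 ^ u := by
  have := Fintype.ofFinite F
  have hu' : 2 ^ u < 2 ^ m := Nat.pow_lt_pow_right (by norm_num) hu
  refine eq_of_natDegree_lt_card_of_eval_eq L _ Function.injective_id (fun x => by simp [h]) ?_
  rw [← Nat.card_eq_fintype_card, hF]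
  exact max_lt hL ((natDegree_C_mul_X_pow_le _ _).trans_lt hu')

variable [Algebra (ZMod 2) F]

lemma isPermutationPoly_C_mul_X_pow {a : F} (ha : a ≠ 0) (u : ℕ) :
    IsPermutationPoly (C a * X ^ 2 ^ u : F[X]) := by
  apply Finite.injective_iff_bijective.1
  intro x y hxy
  simp only [eval_mul, eval_C, eval_pow, eval_X, ← frobPow_apply] at hxy
  exact (frobPow F u).injective (mul_left_cancel₀ ha hxy)

theorem gold_comp_linearized_iff {m k : ℕ} (hm : 5 ≤ m) (hF : Nat.card F = 2 ^ m)
    (hk : 0 < k) (hkm : 2 * k < m) (hkc : k.Coprime m) {L N : F[X]}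
    (hL : IsLinearizedPoly L) (hN : IsLinearizedPoly N)
    (hLd : L.natDegree < 2 ^ m) (hNd : N.natDegree < 2 ^ m) :
    (∀ x : F, goldFunction F k (L.eval x) = N.eval (goldFunction F k x)) ↔
      ∃ (a : F) (u : ℕ), u < m ∧ L = C a * X ^ (2 ^ u) ∧
        N = C (a ^ (2 ^ k + 1)) * X ^ (2 ^ u) := by
  constructor
  · intro h
    obtain ⟨A, hA⟩ := hL.exists_linearMap
    obtain ⟨B, hB⟩ := hN.exists_linearMap
    simp only [goldFunction_eq, ← hA, ← hB] at h
    obtain ⟨a, u, hu, hLa, hNa⟩ := exists_of_gold_comp_eq hm hF hk hkm hkc h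
    exact ⟨a, u, hu, eq_C_mul_X_pow_of_eval hF hLd hu fun x => (hA x).symm.trans (hLa x),
      eq_C_mul_X_pow_of_eval hF hNd hu fun x => (hB x).symm.trans (hNa x)⟩
  · rintro ⟨a, u, -, rfl, rfl⟩ x
    simp only [goldFunction, eval_mul, eval_C, eval_pow, eval_X]
    rw [mul_pow, ← pow_mul, ← pow_mul, mul_comm (2 ^ u)]

end Linearized

theorem mainTheorem4 (m : ℕ) (hm : 5 ≤ m)
    (F : Type*) [Field F] [Finite F] [Algebra (ZMod 2) F] (hF : Nat.card F = 2 ^ m)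
    (k l : ℕ) (hk : 0 < k) (hkm : 2 * k < m) (hkc : Nat.Coprime k m)
    (hl : 0 < l) (hlm : 2 * l < m) (hlc : Nat.Coprime l m) :
    (CCZEquivalent (goldFunction F k) (goldFunction F l) ↔ k = l) ∧
    (k = l →
      LinearlyEquivalent (goldFunction F k) (goldFunction F l) ∧
      ∀ L N : Polynomial F, IsLinearizedPoly L → IsLinearizedPoly N →
        L.natDegree < 2 ^ m → N.natDegree < 2 ^ m →
        ((∀ x : F, goldFunction F k (L.eval x) = N.eval (goldFunction F l x)) ↔
          ∃ (a : F) (u : ℕ), u < m ∧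
            L = Polynomial.C a * Polynomial.X ^ (2 ^ u) ∧
            N = Polynomial.C (a ^ (2 ^ k + 1)) * Polynomial.X ^ (2 ^ u)) ∧
        ((IsPermutationPoly L ∧ IsPermutationPoly N ∧
            ∀ x : F, goldFunction F k (L.eval x) = N.eval (goldFunction F l x)) ↔
          ∃ (a : F) (u : ℕ), a ≠ 0 ∧ u < m ∧
            L = Polynomial.C a * Polynomial.X ^ (2 ^ u) ∧
            N = Polynomial.C (a ^ (2 ^ k + 1)) * Polynomial.X ^ (2 ^ u))) := by
  refine ⟨⟨fun h => ?_, ?_⟩, ?_⟩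
  · by_contra hkl
    exact not_cczEquivalent_gold hm hF hk hkm hkc hlm hlc (Ne.symm hkl) h
  · rintro rfl
    exact ⟨AffineEquiv.refl _ _, by simp⟩
  · rintro rfl
    refine ⟨⟨LinearEquiv.refl _ _, LinearEquiv.refl _ _, fun x => rfl⟩, ?_⟩
    intro L N hL hN hLd hNd
    have hiff := gold_comp_linearized_iff hm hF hk hkm hkc hL hN hLd hNd
    refine ⟨hiff, fun ⟨hLp, _, h⟩ => ?_, ?_⟩
    · obtain ⟨a, u, hu, hLa, hNa⟩ := hiff.1 h
      refine ⟨a, u, ?_, hu, hLa, hNa⟩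
      rintro rfl
      -- With a = 0 the polynomial L is zero and identifies 0 with 1.
      exact zero_ne_one (hLp.1 (a₁ := (0 : F)) (a₂ := 1) (by simp [hLa]))
    · rintro ⟨a, u, ha, hu, rfl, rfl⟩
      exact ⟨isPermutationPoly_C_mul_X_pow ha u,
        isPermutationPoly_C_mul_X_pow (pow_ne_zero _ ha) u,
        hiff.2 ⟨a, u, hu, rfl, rfl⟩⟩
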